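/- All Hilbert spaces are complex, scalar products are linear in the first argument. A linear relation from $X$ to $Y$ is a linear subspace of $X\times Y$, and bounded operators are identified with their graphs. For a linear relation $S$ in a Hilbert space $\mathfrak H$ put $S^*=\{\{g,g'\}:(f',g)=(f,g')\text{ for all }\{f,f'\}\in S\}$; $S$ is symmetric if $S\subset S^*$ and selfadjoint if $S=S^*$. Write $\hat f=\{f,f'\}$, and $\hat f_1\oplus\hat f_2=\{f_1\oplus f_2,f_1'\oplus f_2'\}$. Let $\mathfrak H,\mathcal K$ be Hilbert spaces and $\Gamma$ a linear relation from $\mathfrak H^2$ to $\mathcal K^2$. Green's identity for $\Gamma$ reads $$(f',g)-(f,g')=(h',k)-(h,k')\qquad\text{for all }\{\hat f,\hat h\},\{\hat g,\hat k\}\in\Gamma .\tag{G}$$ $\Gamma$ is a *boundary relation for $S^*$*, where $S$ is a closed symmetric linear relation in $\mathfrak H$, if $\operatorname{dom}\Gamma$ is a dense subspace of $S^*$, (G) holds, and every $\{\hat g,\hat k\}\in\mathfrak H^2\times\mathcal K^2$ that satisfies the equation in (G) for all $\{\hat f,\hat h\}\in\Gamma$ belongs to $\Gamma$. Its *Weyl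 family* is $\lambda\mapsto\{\hat h:\{\{f,\lambda f\},\hat h\}\in\Gamma\text{ for some }f\in\mathfrak H\}$, $\lambda\in\mathbb C\setminus\mathbb R$, called the *Weyl function* when its values are operators. With $\Gamma_0=\{\{\hat f,h\}:\{\hat f,\{h,h'\}\}\in\Gamma\}$, consider the conditions: (B1) (G) holds; (B2) $\operatorname{ran}\Gamma_0=\mathcal K$; (B3) $\ker\Gamma_0$ is selfadjoint. Let $A$ be a symmetric linear relation (for instance, a symmetric operator) in a Hilbert space $\mathfrak H_1$, and let $\{\mathcal H,\Gamma_0,\Gamma_1\}$ be a boundary triplet for $A^*$: $\mathcal H$ is a Hilbert space and $\Gamma_0,\Gamma_1:A^*\to\mathcal H$ are linear maps such that $\{\Gamma_0,\Gamma_1\}:A^*\to\mathcal H^2$ is surjective and $(f',g)-(f,g')=(\Gamma_1\hat f,\Gamma_0\hat g)-(\Gamma_0\hat f,\Gamma_1\hat g)$ for $\hat f,\hat g\in A^*$. Let $M(\lambda)$, a bounded operator on $\mathcal H$ for $\lambda\in\mathbb C\setminus\mathbb R$, be its Weyl function: $\Gamma_1\hat f=M(\lambda)\Gamma_0\hat f$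 for all $\hat f=\{f,\lambda f\}\in A^*$. Let $S_2$ be a closed symmetric linear relation in a Hilbert space $\mathfrak H_2$, and let $\chi$, a linear relation from $\mathfrak H_2^2$ to $\mathcal H^2$, be a boundary relation for $S_2^*$ with domain $T_2$ and Weyl family $\tau(\lambda)$. Let $\{\Phi,\Psi\}$ be a Nevanlinna pair with $\tau(\lambda)=\{\{\Phi(\lambda)h,\Psi(\lambda)h\}:h\in\mathcal H\}$ for $\lambda\in\mathbb C\setminus\mathbb R$; that is, $\Phi,\Psi$ are holomorphic on $\mathbb C\setminus\mathbb R$ with values in the bounded operators on $\mathcal H$, and $\operatorname{Im}(\Phi(\lambda)^*\Psi(\lambda))/\operatorname{Im}\lambda\ge0$, $\Psi(\bar\lambda)^*\Phi(\lambda)=\Phi(\bar\lambda)^*\Psi(\lambda)$, and $\Psi(\lambda)\pm i\Phi(\lambda)$ is boundedly invertible for $\pm\operatorname{Im}\lambda>0$. Then: 1. The linear relation $H^{(1)}=\{\hat f_1\oplus\hat f_2\in A^*\oplus T_2:\ \Gamma_0\hat f_1=0,\ \{\hat f_2,\{0,-\Gamma_1\hat f_1\}\}\in\chi\}$ is closed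 and symmetric in $\mathfrak H_1\oplus\mathfrak H_2$. 2. The linear relation from $(\mathfrak H_1\oplus\mathfrak H_2)^2$ to $\mathcal H^2$ $$\Gamma^{(1)}=\bigl\{\{\hat f_1\oplus\hat f_2,\ \{\Gamma_1\hat f_1+h',\,-\Gamma_0\hat f_1\}\}:\ \hat f_1\in A^*,\ \{\hat f_2,\{\Gamma_0\hat f_1,h'\}\}\in\chi\bigr\}$$ is a boundary relation for $(H^{(1)})^*$ which satisfies (B1)--(B3). 3. For every $\lambda\in\mathbb C\setminus\mathbb R$ the operator $\Psi(\lambda)+M(\lambda)\Phi(\lambda)$ is boundedly invertible, and the Weyl function of $\Gamma^{(1)}$ is $$M^{(1)}(\lambda)=-\Phi(\lambda)\bigl(\Psi(\lambda)+M(\lambda)\Phi(\lambda)\bigr)^{-1}=-(\tau(\lambda)+M(\lambda))^{-1},$$ the last sum and inverse being those of linear relations. 4. The linear relation $H^{(2)}=\{\hat f_1\oplus\hat f_2\in A^*\oplus T_2:\ \Gamma_1\hat f_1=0,\ \{\hat f_2,\{\Gamma_0\hat f_1,0\}\}\in\chi\}$ is closed and symmetric in $\mathfrak H_1\oplus\mathfrak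 H_2$. 5. The linear relation from $(\mathfrak H_1\oplus\mathfrak H_2)^2$ to $\mathcal H^2$ $$\Gamma^{(2)}=\bigl\{\{\hat f_1\oplus\hat f_2,\ \{-\Gamma_0\hat f_1+h,\,-\Gamma_1\hat f_1\}\}:\ \hat f_1\in A^*,\ \{\hat f_2,\{h,-\Gamma_1\hat f_1\}\}\in\chi\bigr\}$$ is a boundary relation for $(H^{(2)})^*$ which satisfies (B1)--(B3). 6. The Weyl function of $\Gamma^{(2)}$ is $$M^{(2)}(\lambda)=\Psi(\lambda)\bigl(\Psi(\lambda)+M(\lambda)\Phi(\lambda)\bigr)^{-1}M(\lambda),\qquad\lambda\in\mathbb C\setminus\mathbb R .$$ -/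

import Mathlib

noncomputable section

namespace BoundaryRel

/-! A linear relation from `X` to `Y` is a linear subspace of `X × Y`. Linear relations in a
Hilbert space `E` are submodules of `E × E`, their adjoint is `Submodule.adjoint`, and linear
relations from `E²` to `K²` are submodules of `(E × E) × (K × K)`. -/

section Relations

variable {X Y : Type*} [AddCommGroup X] [Module ℂ X] [AddCommGroup Y] [Module ℂ Y]

/-- The domain of a linear relation. -/
def relDom (R : Submodule ℂ (X × Y)) : Submodule ℂ X := R.map (LinearMap.fst ℂ X Y)

/-- The range of a linear relation. -/
def relRan (R : Submodule ℂ (X × Y)) : Submodule ℂ Y := R.map (LinearMap.snd ℂ X Y)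

/-- The kernel `{x | {x, 0} ∈ R}` of a linear relation. -/
def relKer (R : Submodule ℂ (X × Y)) : Submodule ℂ X := R.comap (LinearMap.inl ℂ X Y)

end Relations

section Hilbert

variable {E K : Type*}
  [NormedAddCommGroup E] [InnerProductSpace ℂ E] [NormedAddCommGroup K] [InnerProductSpace ℂ K]

/-- Linear relations in `E`. -/
abbrev LinRel (E : Type*) [NormedAddCommGroup E] [InnerProductSpace ℂ E] : Type _ :=
  Submodule ℂ (E × E)

/-- Linear relations from `E²` to `K²`. -/
abbrev BdRel (E K : Type*) [NormedAddCommGroup E] [InnerProductSpace ℂ E]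
    [NormedAddCommGroup K] [InnerProductSpace ℂ K] : Type _ :=
  Submodule ℂ ((E × E) × (K × K))

/-- A linear relation in a Hilbert space `E` is closed if it is closed in `E × E`. -/
def IsClosedRel (S : LinRel E) : Prop := IsClosed (S : Set (E × E))

/-- A linear relation in a Hilbert space is symmetric if it is contained in its adjoint. -/
def IsSymmetricRel (S : LinRel E) : Prop := S ≤ S.adjoint

/-- A linear relation in a Hilbert space is selfadjoint if it is equal to its adjoint. -/
def IsSelfAdjointRel (S : LinRel E) : Prop := S.adjoint = S

/-- Green's identity `(f', g) - (f, g') = (h', k) - (h, k')` for two elements `{{f, f'}, {h, h'}}`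
and `{{g, g'}, {k, k'}}` of `E² × K²`. In Mathlib `inner ℂ y x` is linear in `x`, so it is the
scalar product written `(x, y)` in this identity. -/
def GreenIdentity (p q : (E × E) × (K × K)) : Prop :=
  inner ℂ q.1.1 p.1.2 - inner ℂ q.1.2 p.1.1 = inner ℂ q.2.1 p.2.2 - inner ℂ q.2.2 p.2.1

/-- `Γ : E² → K²` is a boundary relation for `S*`, where `S` is a closed symmetric linear relation
in `E`: the domain of `Γ` is a dense subspace of `S*`, Green's identity holds on `Γ`, and `Γ` is
maximal with this property. -/
structure IsBoundaryRelation (Γ : BdRel E K)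
    (S : LinRel E) : Prop where
  closed : IsClosedRel S
  symmetric : IsSymmetricRel S
  dense_dom : (relDom Γ).topologicalClosure = S.adjoint
  green : ∀ p ∈ Γ, ∀ q ∈ Γ, GreenIdentity p q
  maximal : ∀ q : (E × E) × (K × K), (∀ p ∈ Γ, GreenIdentity p q) → q ∈ Γ

/-- The first component `Γ₀ = {{f̂, h} | {f̂, {h, h'}} ∈ Γ}` of `Γ`. -/
def comp0 (Γ : BdRel E K) : Submodule ℂ ((E × E) × K) :=
  Γ.map ((LinearMap.fst ℂ (E × E) (K × K)).prod
    ((LinearMap.fst ℂ K K).comp (LinearMap.snd ℂ (E × E) (K × K))))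

/-- The three conditions: (B1) Green's identity holds on `Γ`; (B2) `ran Γ₀ = K`;
(B3) `ker Γ₀` is selfadjoint. -/
structure SatisfiesB (Γ : BdRel E K) : Prop where
  b1 : ∀ p ∈ Γ, ∀ q ∈ Γ, GreenIdentity p q
  b2 : relRan (comp0 Γ) = ⊤
  b3 : IsSelfAdjointRel (relKer (comp0 Γ))

/-- The Weyl family of `Γ` at `z`:
`M(z) = {ĥ ∈ K² | {f̂, ĥ} ∈ Γ for some f̂ = {f, z f}}`. -/
def weylFamily (Γ : BdRel E K) (z : ℂ) : LinRel K where
  carrier := {h | ∃ f : E, ((f, z • f), h) ∈ Γ}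
  add_mem' := by
    rintro a b ⟨f, hf⟩ ⟨g, hg⟩
    exact ⟨f + g, by simpa [smul_add] using Γ.add_mem hf hg⟩
  zero_mem' := ⟨0, by rw [smul_zero]; exact Γ.zero_mem⟩
  smul_mem' := by
    rintro c a ⟨f, hf⟩
    exact ⟨c • f, by simpa [smul_comm z c f] using Γ.smul_mem c hf⟩

/-- The operator function `M` is the Weyl function of `Γ`: for every nonreal `z` the Weyl family
of `Γ` at `z` is the graph of the bounded everywhere defined operator `M z`. -/
def IsWeylFunction (Γ : BdRel E K) (M : ℂ → K →L[ℂ] K) : Prop :=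
  ∀ z : ℂ, z.im ≠ 0 → weylFamily Γ z = (M z : K →ₗ[ℂ] K).graph

/-- `{K, Γ₀, Γ₁}` is an (ordinary) boundary triplet for `A*`. -/
structure IsBoundaryTriplet (A : LinRel E) (Γ₀ Γ₁ : A.adjoint →ₗ[ℂ] K) : Prop where
  green : ∀ f g : A.adjoint,
    inner ℂ g.1.1 f.1.2 - inner ℂ g.1.2 f.1.1 = inner ℂ (Γ₀ g) (Γ₁ f) - inner ℂ (Γ₁ g) (Γ₀ f)
  surjective : Function.Surjective (Γ₀.prod Γ₁)

/-- `M` is the Weyl function of the boundary triplet `{K, Γ₀, Γ₁}`: for nonreal `z` one has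
`Γ₁ f̂ = M(z) Γ₀ f̂` for all `f̂ = {f, z f} ∈ A*`. -/
def IsTripletWeylFunction (A : LinRel E) (Γ₀ Γ₁ : A.adjoint →ₗ[ℂ] K)
    (M : ℂ → K →L[ℂ] K) : Prop :=
  ∀ z : ℂ, z.im ≠ 0 → ∀ f : A.adjoint, f.1.2 = z • f.1.1 → Γ₁ f = M z (Γ₀ f)

/-- `{Φ, Ψ}` is a Nevanlinna pair: `Φ` and `Ψ` are holomorphic off the real axis and
(N1) `Im (Φ(z)* Ψ(z)) / Im z ≥ 0`; (N2) `Ψ(z̄)* Φ(z) - Φ(z̄)* Ψ(z) = 0`;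
(N3) `Ψ(z) ± i Φ(z)` is boundedly invertible for `z` in the upper / lower half-plane. -/
structure IsNevanlinnaPair [CompleteSpace K] (Φ Ψ : ℂ → K →L[ℂ] K) : Prop where
  holoΦ : DifferentiableOn ℂ Φ {z | z.im ≠ 0}
  holoΨ : DifferentiableOn ℂ Ψ {z | z.im ≠ 0}
  n1 : ∀ z : ℂ, z.im ≠ 0 → ∀ h : K, 0 ≤ (inner ℂ h ((ContinuousLinearMap.adjoint (Φ z) * Ψ z) h)).im / z.im
  n2 : ∀ z : ℂ, z.im ≠ 0 →
    ContinuousLinearMap.adjoint (Ψ (starRingEnd ℂ z)) * Φ z -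
      ContinuousLinearMap.adjoint (Φ (starRingEnd ℂ z)) * Ψ z = 0
  n3_upper : ∀ z : ℂ, 0 < z.im → IsUnit (Ψ z + Complex.I • Φ z)
  n3_lower : ∀ z : ℂ, z.im < 0 → IsUnit (Ψ z - Complex.I • Φ z)

/-- The family of linear relations `τ(z)` (`z` nonreal) is represented by the pair `{Φ, Ψ}`:
`τ(z) = {{Φ(z) h, Ψ(z) h} | h ∈ K}`. -/
def IsRepresentedBy (τ : ℂ → LinRel K) (Φ Ψ : ℂ → K →L[ℂ] K) : Prop :=
  ∀ z : ℂ, z.im ≠ 0 → τ z = LinearMap.range ((Φ z : K →ₗ[ℂ] K).prod (Ψ z : K →ₗ[ℂ] K))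

end Hilbert

section Coupling

variable {H₁ H₂ K : Type*}
  [NormedAddCommGroup H₁] [InnerProductSpace ℂ H₁]
  [NormedAddCommGroup H₂] [InnerProductSpace ℂ H₂]
  [NormedAddCommGroup K] [InnerProductSpace ℂ K]

/-- `f̂₁ ⊕ f̂₂ = {f₁ ⊕ f₂, f₁' ⊕ f₂'}`, an element of `(H₁ ⊕ H₂)²`, where `H₁ ⊕ H₂` is the
Hilbert space direct sum. -/
def oplus (f₁ : H₁ × H₁) (f₂ : H₂ × H₂) : WithLp 2 (H₁ × H₂) × WithLp 2 (H₁ × H₂) :=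
  (WithLp.toLp 2 (f₁.1, f₂.1), WithLp.toLp 2 (f₁.2, f₂.2))

set_option linter.unusedSectionVars false in
theorem oplus_add (f₁ g₁ : H₁ × H₁) (f₂ g₂ : H₂ × H₂) :
    oplus f₁ f₂ + oplus g₁ g₂ = oplus (f₁ + g₁) (f₂ + g₂) := rfl

theorem smul_oplus (c : ℂ) (f₁ : H₁ × H₁) (f₂ : H₂ × H₂) :
    c • oplus f₁ f₂ = oplus (c • f₁) (c • f₂) := rfl

variable {A : LinRel H₁} (Γ₀ Γ₁ : A.adjoint →ₗ[ℂ] K)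
  (χ : BdRel H₂ K)

/-- `H⁽¹⁾ = {f̂₁ ⊕ f̂₂ | f̂₁ ∈ A*, Γ₀ f̂₁ = 0, {f̂₂, {0, -Γ₁ f̂₁}} ∈ χ}`; the last condition
contains `f̂₂ ∈ dom χ`. -/
def relH1 : LinRel (WithLp 2 (H₁ × H₂)) where
  carrier := {p | ∃ (f₁ : A.adjoint) (f₂ : H₂ × H₂),
    p = oplus f₁.1 f₂ ∧ Γ₀ f₁ = 0 ∧ (f₂, ((0 : K), -Γ₁ f₁)) ∈ χ}
  zero_mem' := ⟨0, 0, rfl, by simp, by rw [map_zero, neg_zero]; exact χ.zero_mem⟩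
  add_mem' := by
    rintro _ _ ⟨f₁, f₂, rfl, h0, h⟩ ⟨g₁, g₂, rfl, k0, k⟩
    refine ⟨f₁ + g₁, f₂ + g₂, oplus_add _ _ _ _, by simp [h0, k0], ?_⟩
    convert χ.add_mem h k using 1
    simp [add_comm]
  smul_mem' := by
    rintro c _ ⟨f₁, f₂, rfl, h0, h⟩
    refine ⟨c • f₁, c • f₂, smul_oplus _ _ _, by simp [h0], ?_⟩
    convert χ.smul_mem c h using 1
    simp

/-- `Γ⁽¹⁾ = {{f̂₁ ⊕ f̂₂, {Γ₁ f̂₁ + h', -Γ₀ f̂₁}} | f̂₁ ∈ A*, {f̂₂, {Γ₀ f̂₁, h'}} ∈ χ}`. -/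
def relGamma1 : BdRel (WithLp 2 (H₁ × H₂)) K where
  carrier := {p | ∃ (f₁ : A.adjoint) (f₂ : H₂ × H₂) (h' : K),
    p = (oplus f₁.1 f₂, (Γ₁ f₁ + h', -Γ₀ f₁)) ∧ (f₂, (Γ₀ f₁, h')) ∈ χ}
  zero_mem' := ⟨0, 0, 0, by rw [map_zero, map_zero, neg_zero, add_zero]; rfl,
    by rw [map_zero]; exact χ.zero_mem⟩
  add_mem' := by
    rintro _ _ ⟨f₁, f₂, h', rfl, h⟩ ⟨g₁, g₂, k', rfl, k⟩
    refine ⟨f₁ + g₁, f₂ + g₂, h' + k', ?_, by simpa using χ.add_mem h k⟩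
    simp only [Prod.mk_add_mk, oplus_add, map_add, Submodule.coe_add, Prod.mk.injEq, true_and]
    exact ⟨by abel, by abel⟩
  smul_mem' := by
    rintro c _ ⟨f₁, f₂, h', rfl, h⟩
    refine ⟨c • f₁, c • f₂, c • h', ?_, by simpa using χ.smul_mem c h⟩
    simp [smul_oplus]

/-- `H⁽²⁾ = {f̂₁ ⊕ f̂₂ | f̂₁ ∈ A*, Γ₁ f̂₁ = 0, {f̂₂, {Γ₀ f̂₁, 0}} ∈ χ}`; the last condition
contains `f̂₂ ∈ dom χ`. -/
def relH2 : LinRel (WithLp 2 (H₁ × H₂)) where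
  carrier := {p | ∃ (f₁ : A.adjoint) (f₂ : H₂ × H₂),
    p = oplus f₁.1 f₂ ∧ Γ₁ f₁ = 0 ∧ (f₂, (Γ₀ f₁, (0 : K))) ∈ χ}
  zero_mem' := ⟨0, 0, rfl, by simp, by rw [map_zero]; exact χ.zero_mem⟩
  add_mem' := by
    rintro _ _ ⟨f₁, f₂, rfl, h0, h⟩ ⟨g₁, g₂, rfl, k0, k⟩
    exact ⟨f₁ + g₁, f₂ + g₂, oplus_add _ _ _ _, by simp [h0, k0], by simpa using χ.add_mem h k⟩
  smul_mem' := by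
    rintro c _ ⟨f₁, f₂, rfl, h0, h⟩
    exact ⟨c • f₁, c • f₂, smul_oplus _ _ _, by simp [h0], by simpa using χ.smul_mem c h⟩

/-- `Γ⁽²⁾ = {{f̂₁ ⊕ f̂₂, {-Γ₀ f̂₁ + h, -Γ₁ f̂₁}} | f̂₁ ∈ A*, {f̂₂, {h, -Γ₁ f̂₁}} ∈ χ}`. -/
def relGamma2 : BdRel (WithLp 2 (H₁ × H₂)) K where
  carrier := {p | ∃ (f₁ : A.adjoint) (f₂ : H₂ × H₂) (h : K),
    p = (oplus f₁.1 f₂, (-Γ₀ f₁ + h, -Γ₁ f₁)) ∧ (f₂, (h, -Γ₁ f₁)) ∈ χ}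
  zero_mem' := ⟨0, 0, 0, by rw [map_zero, map_zero, neg_zero, add_zero]; rfl,
    by rw [map_zero, neg_zero]; exact χ.zero_mem⟩
  add_mem' := by
    rintro _ _ ⟨f₁, f₂, h', rfl, h⟩ ⟨g₁, g₂, k', rfl, k⟩
    refine ⟨f₁ + g₁, f₂ + g₂, h' + k', ?_, ?_⟩
    · simp only [Prod.mk_add_mk, oplus_add, map_add, Submodule.coe_add, Prod.mk.injEq, true_and]
      exact ⟨by abel, by abel⟩
    · convert χ.add_mem h k using 1
      simp [add_comm]
  smul_mem' := by
    rintro c _ ⟨f₁, f₂, h', rfl, h⟩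
    refine ⟨c • f₁, c • f₂, c • h', ?_, ?_⟩
    · simp [smul_oplus]
    · convert χ.smul_mem c h using 1
      simp

end Coupling

end BoundaryRel

end

noncomputable section

namespace BoundaryRel

/-! ### Adjoints of linear relations and solvability for selfadjoint ones. -/

section Adjoint

variable {E : Type*} [NormedAddCommGroup E] [InnerProductSpace ℂ E]

/-! Green's form on the direct sum is the sum of the two forms, and the coupling makes the boundary
terms combine into the form of `relGamma1`. Its maximality reduces to that of `χ` because the
triplet is surjective: elements of `A*` with any prescribed boundary values serve as test elements.
Maximality alone makes the kernel of a relation the adjoint of its domain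
(`isBoundaryRelation_of_green_of_maximal`), which gives closedness, symmetry and density at once.
`relGamma2` is `relGamma1` for the transposed data `Γ₁, -Γ₀, transpose χ`. For the Weyl functions,
(B1)--(B3) force the Weyl family to be everywhere defined and single-valued. The Weyl family of
`relGamma1` consists of the pairs `{(Ψ + MΦ)k, -Φk}`, so these two properties yield surjectivity and
injectivity of `Ψ + MΦ`; bounded invertibility follows by the open mapping theorem. -/

theorem isClosed_adjoint (D : LinRel E) : IsClosedRel D.adjoint := by
  have h : (D.adjoint : Set (E × E)) =
      ⋂ (a : E) (b : E) (_ : (a, b) ∈ D), {x | inner ℂ b x.1 - inner ℂ a x.2 = 0} := by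
    ext x
    simp
  rw [IsClosedRel, h]
  exact isClosed_iInter fun a => isClosed_iInter fun b => isClosed_iInter fun _ =>
    isClosed_eq (by fun_prop) continuous_const

theorem le_adjoint_adjoint (D : LinRel E) : D ≤ D.adjoint.adjoint := by
  rintro ⟨x, y⟩ hx
  rw [Submodule.mem_adjoint_iff]
  intro a b hab
  have h := (Submodule.mem_adjoint_iff _ _).1 hab x y hx
  rw [← inner_conj_symm b, ← inner_conj_symm a, ← map_sub]
  simp only at h ⊢
  rw [← neg_sub, h, neg_zero, map_zero]

/-- Up to the rotation `{x, y} ↦ {y, -x}` the adjoint is the orthogonal complement, so this is `Dᗮᗮ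
= closure D`. Orthogonality is taken in `WithLp 2 (E × E)`; the topology is the same. -/
theorem adjoint_adjoint_eq_topologicalClosure [CompleteSpace E] (D : LinRel E) :
    D.adjoint.adjoint = D.topologicalClosure := by
  refine le_antisymm ?_ (D.topologicalClosure_minimal (le_adjoint_adjoint D) (isClosed_adjoint _))
  intro x hx
  let L : E × E →ₗ[ℂ] WithLp 2 (E × E) := (WithLp.linearEquiv 2 ℂ (E × E)).symm
  have hmem : WithLp.toLp 2 x ∈ (D.map L)ᗮᗮ := by
    rw [Submodule.mem_orthogonal]
    intro y hy
    have hy' : (y.ofLp.2, -y.ofLp.1) ∈ D.adjoint := by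
      rw [Submodule.mem_adjoint_iff]
      intro a b hab
      have := (Submodule.mem_orthogonal _ _).1 hy (L (a, b)) (Submodule.mem_map_of_mem hab)
      rw [WithLp.prod_inner_apply] at this
      change inner ℂ a y.ofLp.1 + inner ℂ b y.ofLp.2 = 0 at this
      simp only [inner_neg_right, sub_neg_eq_add]
      rw [add_comm, this]
    have h := (Submodule.mem_adjoint_iff _ _).1 hx _ _ hy'
    rw [WithLp.prod_inner_apply]
    rw [inner_neg_left] at h
    linear_combination -h
  rw [Submodule.orthogonal_orthogonal_eq_closure] at hmem
  have hc := map_mem_closure (WithLp.prod_continuous_ofLp 2 E E) hmem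
    (t := (D : Set (E × E))) (by
      rintro _ ⟨y, hy, rfl⟩
      exact hy)
  exact hc

/-- For a selfadjoint relation `S` and nonreal `z`, the relation `S - z` is surjective. -/
theorem exists_sub_smul_eq_of_isSelfAdjointRel [CompleteSpace E] {S : LinRel E}
    (hS : IsSelfAdjointRel S) {z : ℂ} (hz : z.im ≠ 0) (k : E) :
    ∃ f ∈ S, f.2 - z • f.1 = k := by
  let T : E × E →L[ℂ] E := ContinuousLinearMap.snd ℂ E E - z • ContinuousLinearMap.fst ℂ E E
  have hT : ∀ f, T f = f.2 - z • f.1 := fun f => rfl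
  have him : ∀ f ∈ S, (inner ℂ f.1 f.2 : ℂ).im = 0 := by
    intro f hf
    have hf' : f ∈ S.adjoint := by rw [hS]; exact hf
    have h := (Submodule.mem_adjoint_iff _ _).1 hf' f.1 f.2 hf
    rw [sub_eq_zero, ← inner_conj_symm] at h
    exact Complex.conj_eq_iff_im.1 h
  -- As `(f', f)` is real on `S`, the imaginary part of `(f' - z f, f)` is `-Im z ‖f‖²`.
  have hbound : ∀ f ∈ S, |z.im| * ‖f.1‖ ≤ ‖T f‖ := by
    intro f hf
    have h1 : (inner ℂ f.1 (T f) : ℂ).im = -(z.im * ‖f.1‖ ^ 2) := by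
      rw [hT, inner_sub_right, inner_smul_right, inner_self_eq_norm_sq_to_K, Complex.sub_im,
        him f hf]
      simp [← Complex.ofReal_pow]
    have h2 : |z.im| * ‖f.1‖ ^ 2 ≤ ‖f.1‖ * ‖T f‖ := by
      calc |z.im| * ‖f.1‖ ^ 2 = |(inner ℂ f.1 (T f) : ℂ).im| := by
            rw [h1, abs_neg, abs_mul, abs_of_nonneg (sq_nonneg ‖f.1‖)]
        _ ≤ ‖(inner ℂ f.1 (T f) : ℂ)‖ := Complex.abs_im_le_norm _
        _ ≤ _ := norm_inner_le_norm _ _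
    rcases (norm_nonneg f.1).eq_or_lt with h0 | h0
    · rw [← h0, mul_zero]; exact norm_nonneg _
    · exact le_of_mul_le_mul_left (by linarith [h2]) h0
  have hclosed : IsClosed (S : Set (E × E)) := by
    have := isClosed_adjoint S
    rwa [IsClosedRel, hS] at this
  have hzpos : 0 < |z.im| := abs_pos.2 hz
  let T' : S →L[ℂ] E := T.comp S.subtypeL
  -- The bound on `f` also controls `f' = T f + z f`, hence the whole graph norm; since `S` is
  -- complete, the range of `S - z` is closed.
  have hanti : AntilipschitzWith (Real.toNNReal (max (|z.im|⁻¹) (1 + ‖z‖ * |z.im|⁻¹))) T' := by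
    refine ContinuousLinearMap.antilipschitz_of_bound _ fun f => ?_
    have hb := hbound f.1 f.2
    have h1 : ‖f.1.1‖ ≤ |z.im|⁻¹ * ‖T f.1‖ := by
      rw [inv_mul_eq_div, le_div_iff₀ hzpos]; linarith
    have h2 : ‖f.1.2‖ ≤ (1 + ‖z‖ * |z.im|⁻¹) * ‖T f.1‖ := by
      have : f.1.2 = T f.1 + z • f.1.1 := by rw [hT]; abel
      calc ‖f.1.2‖ ≤ ‖T f.1‖ + ‖z‖ * ‖f.1.1‖ := by
            rw [this, ← norm_smul]; exact norm_add_le _ _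
        _ ≤ ‖T f.1‖ + ‖z‖ * (|z.im|⁻¹ * ‖T f.1‖) := by gcongr
        _ = _ := by ring
    have h0 : 0 ≤ max (|z.im|⁻¹) (1 + ‖z‖ * |z.im|⁻¹) := le_max_of_le_left (by positivity)
    rw [Real.coe_toNNReal _ h0]
    change max ‖f.1.1‖ ‖f.1.2‖ ≤ _ * ‖T f.1‖
    refine max_le (h1.trans ?_) (h2.trans ?_)
    · gcongr; exact le_max_left _ _
    · gcongr; exact le_max_right _ _
  have : CompleteSpace S := hclosed.completeSpace_coe
  have hrange : IsClosed (Set.range T') := hanti.isClosed_range T'.uniformContinuous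
  let R : Submodule ℂ E := LinearMap.range (T' : S →ₗ[ℂ] E)
  have hRc : IsClosed (R : Set E) := hrange
  have : CompleteSpace R := hRc.completeSpace_coe
  -- A vector `g` orthogonal to the range gives `{g, z̄ g} ∈ S* = S`, and reality of the form forces
  -- `g = 0`.
  have hbot : Rᗮ = ⊥ := by
    rw [eq_bot_iff]
    intro g hg
    rw [Submodule.mem_orthogonal] at hg
    have hgS : (g, (starRingEnd ℂ z) • g) ∈ S := by
      rw [← hS, Submodule.mem_adjoint_iff]
      intro a b hab
      have := hg (T (a, b)) ⟨⟨(a, b), hab⟩, rfl⟩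
      rw [hT, inner_sub_left, inner_smul_left] at this
      rw [inner_smul_right]
      exact this
    have h := him _ hgS
    rw [inner_smul_right, inner_self_eq_norm_sq_to_K] at h
    simp [← Complex.ofReal_pow, hz] at h
    simpa using h
  have htop : R = ⊤ := (Submodule.orthogonal_eq_bot_iff).1 hbot
  obtain ⟨f, hf⟩ : k ∈ R := htop ▸ Submodule.mem_top
  exact ⟨f.1, f.2, hf⟩

end Adjoint

/-! ### Consequences of maximality and of (B1)--(B3). -/

section General

variable {E K : Type*}
  [NormedAddCommGroup E] [InnerProductSpace ℂ E] [NormedAddCommGroup K] [InnerProductSpace ℂ K]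

theorem mem_relDom_iff {Γ : BdRel E K} {f : E × E} : f ∈ relDom Γ ↔ ∃ h, (f, h) ∈ Γ := by
  simp [relDom]

theorem mem_relKer_comp0_iff {Γ : BdRel E K} {f : E × E} :
    f ∈ relKer (comp0 Γ) ↔ ∃ h', (f, ((0 : K), h')) ∈ Γ := by
  constructor
  · rintro ⟨⟨g, h, h'⟩, hp, he⟩
    have he' : (g, h) = (f, (0 : K)) := he
    obtain ⟨rfl, rfl⟩ := Prod.mk_inj.1 he'
    exact ⟨h', hp⟩
  · rintro ⟨h', hp⟩
    exact ⟨_, hp, rfl⟩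

theorem mem_relRan_comp0_iff {Γ : BdRel E K} {h : K} :
    h ∈ relRan (comp0 Γ) ↔ ∃ f h', (f, (h, h')) ∈ Γ := by
  constructor
  · rintro ⟨_, ⟨⟨f, k, h'⟩, hp, rfl⟩, he⟩
    obtain rfl : k = h := he
    exact ⟨f, h', hp⟩
  · rintro ⟨f, h', hp⟩
    exact ⟨_, ⟨_, hp, rfl⟩, rfl⟩

/-- A relation which is maximal with respect to Green's identity is a boundary relation for the
adjoint of its kernel. -/
theorem isBoundaryRelation_of_green_of_maximal [CompleteSpace E] {Γ : BdRel E K} {S : LinRel E}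
    (hS : ∀ f, f ∈ S ↔ (f, ((0 : K), (0 : K))) ∈ Γ)
    (hgreen : ∀ p ∈ Γ, ∀ q ∈ Γ, GreenIdentity p q)
    (hmax : ∀ q : (E × E) × (K × K), (∀ p ∈ Γ, GreenIdentity p q) → q ∈ Γ) :
    IsBoundaryRelation Γ S := by
  -- For `q = {ĝ, 0}` the boundary side of Green's identity vanishes, so the identity says that `ĝ`
  -- lies in the adjoint of the domain. The conjugations only swap the arguments of the scalar
  -- products.
  have hadj : (relDom Γ).adjoint = S := by
    ext g
    rw [hS, Submodule.mem_adjoint_iff]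
    constructor
    · intro h
      refine hmax _ fun p hp => ?_
      have := h p.1.1 p.1.2 (mem_relDom_iff.2 ⟨_, hp⟩)
      have h2 := congrArg (starRingEnd ℂ) this
      simpa [GreenIdentity] using h2
    · intro h a b hab
      obtain ⟨k, hk⟩ := mem_relDom_iff.1 hab
      have h2 := congrArg (starRingEnd ℂ) (hgreen _ hk _ h)
      simpa [GreenIdentity] using h2
  have hdense : (relDom Γ).topologicalClosure = S.adjoint := by
    rw [← hadj, adjoint_adjoint_eq_topologicalClosure]
  refine ⟨hadj ▸ isClosed_adjoint _, ?_, hdense, hgreen, hmax⟩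
  intro f hf
  rw [← hdense]
  exact (relDom Γ).le_topologicalClosure (mem_relDom_iff.2 ⟨_, (hS f).1 hf⟩)

/-- (B2) gives some `f̂` with first boundary value `u`. By (B3), `ker Γ₀ - z` is surjective, so
subtracting a suitable element of `ker Γ₀` turns `f̂` into an eigenelement without changing `u`. -/
theorem SatisfiesB.exists_mem_weylFamily [CompleteSpace E] {Γ : BdRel E K} (hB : SatisfiesB Γ)
    {z : ℂ} (hz : z.im ≠ 0) (u : K) : ∃ v, (u, v) ∈ weylFamily Γ z := by
  obtain ⟨f, h', hf⟩ := mem_relRan_comp0_iff.1 (hB.b2 ▸ Submodule.mem_top : u ∈ relRan (comp0 Γ))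
  obtain ⟨g, hg, hgf⟩ := exists_sub_smul_eq_of_isSelfAdjointRel hB.b3 hz (f.2 - z • f.1)
  obtain ⟨k', hk⟩ := mem_relKer_comp0_iff.1 hg
  refine ⟨h' - k', f.1 - g.1, ?_⟩
  have hs : f.2 - g.2 = z • (f.1 - g.1) := by
    rw [smul_sub, sub_eq_sub_iff_sub_eq_sub]
    exact hgf.symm
  have := Γ.sub_mem hf hk
  rw [← hs]
  rwa [Prod.mk_sub_mk, Prod.mk_sub_mk, Prod.mk_sub_mk, sub_zero] at this

/-- Green's identity of the element with itself reads `(z - z̄)‖f‖² = 0`, so `f = 0`; pairing then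
with an element whose first boundary value is `v` gives `‖v‖² = 0`. -/
theorem SatisfiesB.eq_zero_of_mem_weylFamily {Γ : BdRel E K} (hB : SatisfiesB Γ)
    {z : ℂ} (hz : z.im ≠ 0) {v : K} (hv : (0, v) ∈ weylFamily Γ z) : v = 0 := by
  obtain ⟨f, hf⟩ := hv
  have hf0 : f = 0 := by
    have h := hB.b1 _ hf _ hf
    simp only [GreenIdentity, inner_smul_right, inner_smul_left, inner_zero_left,
      inner_zero_right, sub_zero, ← sub_mul] at h
    rcases mul_eq_zero.1 h with h | h
    · exact absurd (Complex.conj_eq_iff_im.1 (sub_eq_zero.1 h).symm) hz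
    · exact inner_self_eq_zero.1 h
  subst hf0
  obtain ⟨g, h', hg⟩ := mem_relRan_comp0_iff.1 (hB.b2 ▸ Submodule.mem_top : v ∈ relRan (comp0 Γ))
  have h := hB.b1 _ hg _ hf
  simpa [GreenIdentity] using h

end General

/-! ### Boundary triplets. -/

section Triplet

variable {E K : Type*}
  [NormedAddCommGroup E] [InnerProductSpace ℂ E] [NormedAddCommGroup K] [InnerProductSpace ℂ K]
  {A : LinRel E} {Γ₀ Γ₁ : A.adjoint →ₗ[ℂ] K}

theorem IsBoundaryTriplet.exists_eq (hΓ : IsBoundaryTriplet A Γ₀ Γ₁) (h h' : K) :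
    ∃ f, Γ₀ f = h ∧ Γ₁ f = h' := by
  obtain ⟨f, hf⟩ := hΓ.surjective (h, h')
  exact ⟨f, congrArg Prod.fst hf, congrArg Prod.snd hf⟩

theorem IsBoundaryTriplet.transpose (hΓ : IsBoundaryTriplet A Γ₀ Γ₁) :
    IsBoundaryTriplet A Γ₁ (-Γ₀) where
  green f g := by
    rw [hΓ.green]
    simp only [LinearMap.neg_apply, inner_neg_left, inner_neg_right]
    ring
  surjective := by
    rintro ⟨h, h'⟩
    obtain ⟨f, h0, h1⟩ := hΓ.exists_eq (-h') h
    exact ⟨f, by simp [h0, h1]⟩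

/-- The boundary maps vanish on the minimal relation. -/
theorem IsBoundaryTriplet.eq_zero_of_mem (hΓ : IsBoundaryTriplet A Γ₀ Γ₁) {f : A.adjoint}
    (hf : f.1 ∈ A) : Γ₀ f = 0 ∧ Γ₁ f = 0 := by
  have key : ∀ g, inner ℂ (Γ₀ g) (Γ₁ f) - inner ℂ (Γ₁ g) (Γ₀ f) = 0 := by
    intro g
    rw [← hΓ.green]
    have h2 := congrArg (starRingEnd ℂ) ((Submodule.mem_adjoint_iff _ _).1 g.2 f.1.1 f.1.2 hf)
    simpa using h2
  constructor
  · obtain ⟨g, h0, h1⟩ := hΓ.exists_eq 0 (Γ₀ f)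
    simpa [h0, h1] using key g
  · obtain ⟨g, h0, h1⟩ := hΓ.exists_eq (Γ₁ f) 0
    simpa [h0, h1] using key g

theorem mem_adjoint_of_forall_green {g : E × E}
    (h : ∀ f ∈ A, inner ℂ g.1 f.2 - inner ℂ g.2 f.1 = 0) : g ∈ A.adjoint := by
  rw [Submodule.mem_adjoint_iff]
  intro a b hab
  simpa using congrArg (starRingEnd ℂ) (h _ hab)

/-- `ker Γ₀` is selfadjoint, so any `f̂ ∈ A*` with `Γ₀ f̂ = h` can be corrected by an element of
`ker Γ₀` to an eigenelement. -/
theorem IsBoundaryTriplet.exists_eigen [CompleteSpace E] (hA : IsSymmetricRel A)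
    (hΓ : IsBoundaryTriplet A Γ₀ Γ₁) {z : ℂ} (hz : z.im ≠ 0) (h : K) :
    ∃ f : A.adjoint, f.1.2 = z • f.1.1 ∧ Γ₀ f = h := by
  let S : LinRel E := (LinearMap.ker Γ₀).map A.adjoint.subtype
  have hmem : ∀ f : A.adjoint, Γ₀ f = 0 → f.1 ∈ S := fun f hf => ⟨f, hf, rfl⟩
  have hS : IsSelfAdjointRel S := by
    apply le_antisymm
    · intro g hg
      have hg' : ∀ f : A.adjoint, Γ₀ f = 0 → inner ℂ g.1 f.1.2 - inner ℂ g.2 f.1.1 = 0 := by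
        intro f hf
        have := (Submodule.mem_adjoint_iff _ _).1 hg f.1.1 f.1.2 (hmem f hf)
        simpa using congrArg (starRingEnd ℂ) this
      have hgA : g ∈ A.adjoint := mem_adjoint_of_forall_green fun f hf =>
        hg' ⟨f, hA hf⟩ (hΓ.eq_zero_of_mem hf).1
      obtain ⟨f, h0, h1⟩ := hΓ.exists_eq 0 (Γ₀ ⟨g, hgA⟩)
      have := hg' f h0
      rw [hΓ.green f ⟨g, hgA⟩, h0, h1] at this
      exact hmem ⟨g, hgA⟩ (by simpa using this)
    · rintro _ ⟨g, hg, rfl⟩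
      rw [Submodule.mem_adjoint_iff]
      rintro a b ⟨f, hf, hab⟩
      have := hΓ.green f g
      rw [LinearMap.mem_ker.1 hf, LinearMap.mem_ker.1 hg] at this
      have hab' : f.1 = (a, b) := hab
      rw [hab'] at this
      simpa using congrArg (starRingEnd ℂ) this
  obtain ⟨f, h0, -⟩ := hΓ.exists_eq h 0
  obtain ⟨_, ⟨g, hg, rfl⟩, hgf⟩ := exists_sub_smul_eq_of_isSelfAdjointRel hS hz (f.1.2 - z • f.1.1)
  refine ⟨f - g, ?_, by rw [map_sub, LinearMap.mem_ker.1 hg, h0, sub_zero]⟩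
  change f.1.2 - g.1.2 = z • (f.1.1 - g.1.1)
  rw [smul_sub, sub_eq_sub_iff_sub_eq_sub]
  exact hgf.symm

end Triplet

/-! ### The coupled relations on the direct sum. -/

section Coupling

variable {H₁ H₂ K : Type*}
  [NormedAddCommGroup H₁] [InnerProductSpace ℂ H₁]
  [NormedAddCommGroup H₂] [InnerProductSpace ℂ H₂]
  [NormedAddCommGroup K] [InnerProductSpace ℂ K]

/-- Green's form on the direct sum is the sum of the forms of the summands. -/
theorem inner_oplus (f₁ g₁ : H₁ × H₁) (f₂ g₂ : H₂ × H₂) :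
    inner ℂ (oplus g₁ g₂).1 (oplus f₁ f₂).2 - inner ℂ (oplus g₁ g₂).2 (oplus f₁ f₂).1 =
      (inner ℂ g₁.1 f₁.2 - inner ℂ g₁.2 f₁.1) + (inner ℂ g₂.1 f₂.2 - inner ℂ g₂.2 f₂.1) := by
  simp only [oplus, WithLp.prod_inner_apply]
  ring

set_option linter.unusedSectionVars false in
theorem exists_eq_oplus (g : WithLp 2 (H₁ × H₂) × WithLp 2 (H₁ × H₂)) :
    ∃ g₁ g₂, g = oplus g₁ g₂ :=
  ⟨(g.1.fst, g.2.fst), (g.1.snd, g.2.snd), rfl⟩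

set_option linter.unusedSectionVars false in
theorem oplus_inj {f₁ g₁ : H₁ × H₁} {f₂ g₂ : H₂ × H₂} :
    oplus f₁ f₂ = oplus g₁ g₂ ↔ f₁ = g₁ ∧ f₂ = g₂ := by
  constructor
  · intro h
    have h1 := congrArg (fun p => (p.1.fst, p.2.fst)) h
    have h2 := congrArg (fun p => (p.1.snd, p.2.snd)) h
    exact ⟨h1, h2⟩
  · rintro ⟨rfl, rfl⟩
    rfl

theorem oplus_eq_smul_iff {f₁ : H₁ × H₁} {f₂ : H₂ × H₂} {f : WithLp 2 (H₁ × H₂)} {z : ℂ} :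
    (f, z • f) = oplus f₁ f₂ ↔ f₁ = (f.fst, z • f.fst) ∧ f₂ = (f.snd, z • f.snd) := by
  rw [show (f, z • f) = oplus (f.fst, z • f.fst) (f.snd, z • f.snd) from rfl, oplus_inj,
    eq_comm, @eq_comm _ _ f₂]

/-- The relation `{{f̂, {-h', h}} | {f̂, {h, h'}} ∈ χ}`. -/
def transpose (χ : BdRel H₂ K) : BdRel H₂ K :=
  χ.comap ((LinearMap.fst ℂ (H₂ × H₂) (K × K)).prod
    (((LinearMap.snd ℂ K K).prod (-LinearMap.fst ℂ K K)).comp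
      (LinearMap.snd ℂ (H₂ × H₂) (K × K))))

theorem mem_transpose_iff {χ : BdRel H₂ K} {f : H₂ × H₂} {h h' : K} :
    (f, (h, h')) ∈ transpose χ ↔ (f, (h', -h)) ∈ χ := Iff.rfl

theorem transpose_green {χ : BdRel H₂ K} (hgreen : ∀ p ∈ χ, ∀ q ∈ χ, GreenIdentity p q) :
    ∀ p ∈ transpose χ, ∀ q ∈ transpose χ, GreenIdentity p q := by
  rintro ⟨f, h, h'⟩ hp ⟨g, k, k'⟩ hq
  have := hgreen _ (mem_transpose_iff.1 hp) _ (mem_transpose_iff.1 hq)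
  simp only [GreenIdentity, inner_neg_left, inner_neg_right] at this ⊢
  rw [this]
  ring

theorem transpose_maximal {χ : BdRel H₂ K}
    (hmax : ∀ q : (H₂ × H₂) × (K × K), (∀ p ∈ χ, GreenIdentity p q) → q ∈ χ) :
    ∀ q : (H₂ × H₂) × (K × K), (∀ p ∈ transpose χ, GreenIdentity p q) → q ∈ transpose χ := by
  rintro ⟨g, k, k'⟩ hq
  rw [mem_transpose_iff]
  refine hmax _ ?_
  rintro ⟨f, h, h'⟩ hp
  have := hq (f, (-h', h)) (by rw [mem_transpose_iff, neg_neg]; exact hp)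
  simp only [GreenIdentity, inner_neg_left, inner_neg_right] at this ⊢
  rw [this]
  ring

variable {A : LinRel H₁} {Γ₀ Γ₁ : A.adjoint →ₗ[ℂ] K} {χ : BdRel H₂ K}

/-- This identity and `relH2_eq` transfer everything but the Weyl function from the first coupling
to the second. -/
theorem relGamma2_eq : relGamma2 Γ₀ Γ₁ χ = relGamma1 Γ₁ (-Γ₀) (transpose χ) := rfl

theorem relH2_eq : relH2 Γ₀ Γ₁ χ = relH1 Γ₁ (-Γ₀) (transpose χ) := by
  ext p
  constructor
  · rintro ⟨f₁, f₂, hp, h1, h⟩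
    refine ⟨f₁, f₂, hp, h1, ?_⟩
    rw [mem_transpose_iff]
    simpa using h
  · rintro ⟨f₁, f₂, hp, h1, h⟩
    refine ⟨f₁, f₂, hp, h1, ?_⟩
    rw [mem_transpose_iff] at h
    simpa using h

theorem oplus_mem_relGamma1_iff {g₁ : H₁ × H₁} {g₂ : H₂ × H₂} {k k' : K} :
    (oplus g₁ g₂, (k, k')) ∈ relGamma1 Γ₀ Γ₁ χ ↔
      ∃ hg : g₁ ∈ A.adjoint, k' = -Γ₀ ⟨g₁, hg⟩ ∧
        (g₂, (Γ₀ ⟨g₁, hg⟩, k - Γ₁ ⟨g₁, hg⟩)) ∈ χ := by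
  constructor
  · rintro ⟨f₁, f₂, h', hp, h⟩
    obtain ⟨h1, h2⟩ := Prod.mk_inj.1 hp
    obtain ⟨rfl, rfl⟩ := Prod.mk_inj.1 h2
    obtain ⟨rfl, rfl⟩ := oplus_inj.1 h1
    exact ⟨f₁.2, rfl, by simpa using h⟩
  · rintro ⟨hg, rfl, h⟩
    exact ⟨⟨g₁, hg⟩, g₂, _, by simp, h⟩

theorem relGamma1_green (hΓ : IsBoundaryTriplet A Γ₀ Γ₁)
    (hgreen : ∀ p ∈ χ, ∀ q ∈ χ, GreenIdentity p q) :
    ∀ p ∈ relGamma1 Γ₀ Γ₁ χ, ∀ q ∈ relGamma1 Γ₀ Γ₁ χ, GreenIdentity p q := by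
  rintro _ ⟨f₁, f₂, h', rfl, hf⟩ _ ⟨g₁, g₂, k', rfl, hg⟩
  have h1 := hΓ.green f₁ g₁
  have h2 := hgreen _ hf _ hg
  simp only [GreenIdentity, inner_oplus, inner_neg_left, inner_neg_right, inner_add_left,
    inner_add_right] at h2 ⊢
  rw [h1, h2]
  ring

theorem relGamma1_maximal (hA : IsSymmetricRel A) (hΓ : IsBoundaryTriplet A Γ₀ Γ₁)
    (hmax : ∀ q : (H₂ × H₂) × (K × K), (∀ p ∈ χ, GreenIdentity p q) → q ∈ χ) :
    ∀ q, (∀ p ∈ relGamma1 Γ₀ Γ₁ χ, GreenIdentity p q) → q ∈ relGamma1 Γ₀ Γ₁ χ := by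
  rintro ⟨g, k, k'⟩ hq
  obtain ⟨g₁, g₂, rfl⟩ := exists_eq_oplus g
  have hq' : ∀ (f₁ : A.adjoint) (f₂ : H₂ × H₂) (h' : K), (f₂, (Γ₀ f₁, h')) ∈ χ →
      (inner ℂ g₁.1 f₁.1.2 - inner ℂ g₁.2 f₁.1.1) + (inner ℂ g₂.1 f₂.2 - inner ℂ g₂.2 f₂.1) =
        inner ℂ k (-Γ₀ f₁) - inner ℂ k' (Γ₁ f₁ + h') := fun f₁ f₂ h' h => by
    rw [← inner_oplus]
    exact hq _ ⟨f₁, f₂, h', rfl, h⟩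
  -- Test elements `f̂ ⊕ 0` with `f̂ ∈ A`: all boundary values vanish.
  have hg : g₁ ∈ A.adjoint := mem_adjoint_of_forall_green fun f hf => by
    obtain ⟨h0, h1⟩ := hΓ.eq_zero_of_mem (f := ⟨f, hA hf⟩) hf
    have := hq' ⟨f, hA hf⟩ 0 0 (by rw [h0]; exact χ.zero_mem)
    simpa [h0, h1] using this
  -- Test element `f̂ ⊕ 0` with `Γ₀ f̂ = 0` and `Γ₁ f̂` equal to the difference that has to vanish.
  have hk' : k' = -Γ₀ ⟨g₁, hg⟩ := by
    obtain ⟨f, h0, h1⟩ := hΓ.exists_eq 0 (Γ₀ ⟨g₁, hg⟩ + k')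
    have := hq' f 0 0 (by rw [h0]; exact χ.zero_mem)
    rw [hΓ.green f ⟨g₁, hg⟩, h0, h1] at this
    rw [eq_neg_iff_add_eq_zero, ← inner_self_eq_zero (𝕜 := ℂ), add_comm k', inner_add_left]
    simp only [Prod.fst_zero, Prod.snd_zero, inner_zero_right, neg_zero, add_zero, sub_zero,
      zero_sub] at this
    rw [this]
    ring
  refine oplus_mem_relGamma1_iff.2 ⟨hg, hk', hmax _ ?_⟩
  rintro ⟨f₂, h, h'⟩ hf
  -- Any element of `χ` extends to a test element; with `Γ₁ f̂ = 0` what remains is Green's identity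
  -- for `χ`.
  obtain ⟨f, h0, h1⟩ := hΓ.exists_eq h 0
  have := hq' f f₂ h' (by rw [h0]; exact hf)
  rw [hΓ.green f ⟨g₁, hg⟩, h0, h1, hk'] at this
  simp only [GreenIdentity, inner_sub_left, inner_neg_left, inner_neg_right, inner_add_right,
    inner_zero_right] at this ⊢
  linear_combination this

theorem relGamma1_isBoundaryRelation [CompleteSpace H₁] [CompleteSpace H₂]
    (hA : IsSymmetricRel A) (hΓ : IsBoundaryTriplet A Γ₀ Γ₁)
    (hgreen : ∀ p ∈ χ, ∀ q ∈ χ, GreenIdentity p q)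
    (hmax : ∀ q : (H₂ × H₂) × (K × K), (∀ p ∈ χ, GreenIdentity p q) → q ∈ χ) :
    IsBoundaryRelation (relGamma1 Γ₀ Γ₁ χ) (relH1 Γ₀ Γ₁ χ) := by
  refine isBoundaryRelation_of_green_of_maximal (fun f => ?_) (relGamma1_green hΓ hgreen)
    (relGamma1_maximal hA hΓ hmax)
  constructor
  · rintro ⟨f₁, f₂, rfl, h0, h⟩
    exact ⟨f₁, f₂, -Γ₁ f₁, by simp [h0], by rw [h0]; exact h⟩
  · rintro ⟨f₁, f₂, h', hp, h⟩
    obtain ⟨rfl, h2⟩ := Prod.mk_inj.1 hp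
    obtain ⟨h3, h4⟩ := Prod.mk_inj.1 h2
    have h0 : Γ₀ f₁ = 0 := neg_eq_zero.1 h4.symm
    refine ⟨f₁, f₂, rfl, h0, ?_⟩
    rwa [h0, eq_neg_of_add_eq_zero_right h3.symm] at h

theorem relGamma1_satisfiesB (hA : IsSymmetricRel A) (hΓ : IsBoundaryTriplet A Γ₀ Γ₁)
    (hgreen : ∀ p ∈ χ, ∀ q ∈ χ, GreenIdentity p q)
    (hmax : ∀ q : (H₂ × H₂) × (K × K), (∀ p ∈ χ, GreenIdentity p q) → q ∈ χ) :
    SatisfiesB (relGamma1 Γ₀ Γ₁ χ) := by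
  have hG := relGamma1_green hΓ hgreen
  refine ⟨hG, ?_, ?_⟩
  · rw [eq_top_iff]
    rintro u -
    obtain ⟨f, h0, h1⟩ := hΓ.exists_eq 0 u
    exact mem_relRan_comp0_iff.2 ⟨oplus f.1 0, -Γ₀ f, f, 0, 0, by rw [h1, add_zero],
      by rw [h0]; exact χ.zero_mem⟩
  · apply le_antisymm
    · intro g hg
      obtain ⟨g₁, g₂, rfl⟩ := exists_eq_oplus g
      have hg' : ∀ (f₁ : A.adjoint) (f₂ : H₂ × H₂), (f₂, (Γ₀ f₁, -Γ₁ f₁)) ∈ χ →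
          (inner ℂ g₁.1 f₁.1.2 - inner ℂ g₁.2 f₁.1.1) +
            (inner ℂ g₂.1 f₂.2 - inner ℂ g₂.2 f₂.1) = 0 := fun f₁ f₂ h => by
        have := (Submodule.mem_adjoint_iff _ _).1 hg (oplus f₁.1 f₂).1 (oplus f₁.1 f₂).2
          (mem_relKer_comp0_iff.2 ⟨-Γ₀ f₁, f₁, f₂, -Γ₁ f₁, by rw [add_neg_cancel], h⟩)
        rw [← inner_oplus]
        simpa only [map_sub, inner_conj_symm, map_zero] using congrArg (starRingEnd ℂ) this
      have hgA : g₁ ∈ A.adjoint := mem_adjoint_of_forall_green fun f hf => by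
        obtain ⟨h0, h1⟩ := hΓ.eq_zero_of_mem (f := ⟨f, hA hf⟩) hf
        have := hg' ⟨f, hA hf⟩ 0 (by rw [h0, h1, neg_zero]; exact χ.zero_mem)
        simpa using this
      refine mem_relKer_comp0_iff.2 ⟨_, oplus_mem_relGamma1_iff.2 ⟨hgA, rfl, hmax _ ?_⟩⟩
      -- On `ker Γ₀` the coupling is `{f̂₂, {Γ₀ f̂₁, -Γ₁ f̂₁}} ∈ χ`, so any element of `χ` is
      -- matched by an `f̂₁` with boundary values `h, -h'`.
      rintro ⟨f₂, h, h'⟩ hf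
      obtain ⟨f, h0, h1⟩ := hΓ.exists_eq h (-h')
      have := hg' f f₂ (by rw [h0, h1, neg_neg]; exact hf)
      rw [hΓ.green f ⟨g₁, hgA⟩, h0, h1] at this
      simp only [GreenIdentity, zero_sub, inner_neg_left, inner_neg_right] at this ⊢
      linear_combination this
    · intro g hg
      obtain ⟨k', hk⟩ := mem_relKer_comp0_iff.1 hg
      rw [Submodule.mem_adjoint_iff]
      intro a b hab
      obtain ⟨h', hh⟩ := mem_relKer_comp0_iff.1 hab
      have := hG _ hh _ hk
      simp only [GreenIdentity, inner_zero_left, inner_zero_right, sub_zero] at this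
      simpa only [map_sub, inner_conj_symm, map_zero] using congrArg (starRingEnd ℂ) this

theorem mem_weylFamily_relGamma1_iff [CompleteSpace H₁] (hA : IsSymmetricRel A)
    (hΓ : IsBoundaryTriplet A Γ₀ Γ₁) {M : ℂ → K →L[ℂ] K}
    (hM : IsTripletWeylFunction A Γ₀ Γ₁ M) {z : ℂ} (hz : z.im ≠ 0) {u v : K} :
    (u, v) ∈ weylFamily (relGamma1 Γ₀ Γ₁ χ) z ↔
      ∃ w : K, (-v, w) ∈ weylFamily χ z ∧ u = w + M z (-v) := by
  constructor
  · rintro ⟨f, f₁, f₂, h', hp, h⟩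
    obtain ⟨h1, h2⟩ := Prod.mk_inj.1 hp
    obtain ⟨rfl, rfl⟩ := Prod.mk_inj.1 h2
    obtain ⟨hf₁, rfl⟩ := oplus_eq_smul_iff.1 h1
    refine ⟨h', ⟨f.snd, by rwa [neg_neg]⟩, ?_⟩
    rw [neg_neg, ← hM z hz f₁ (by rw [hf₁]), add_comm]
  · rintro ⟨w, ⟨g, hg⟩, rfl⟩
    obtain ⟨f, hf, h0⟩ := hΓ.exists_eigen hA hz (-v)
    refine ⟨WithLp.toLp 2 (f.1.1, g), f, (g, z • g), w, ?_, by rwa [h0]⟩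
    rw [hM z hz f hf, h0, neg_neg, add_comm]
    refine Prod.mk_inj.2 ⟨oplus_eq_smul_iff.2 ⟨Prod.ext rfl hf, rfl⟩, rfl⟩

/-- Computed directly, with `a = Γ₀ f̂₁`: the transposed triplet would bring in `-M⁻¹` in place of
`M`. -/
theorem mem_weylFamily_relGamma2_iff [CompleteSpace H₁] (hA : IsSymmetricRel A)
    (hΓ : IsBoundaryTriplet A Γ₀ Γ₁) {M : ℂ → K →L[ℂ] K}
    (hM : IsTripletWeylFunction A Γ₀ Γ₁ M) {z : ℂ} (hz : z.im ≠ 0) {u v : K} :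
    (u, v) ∈ weylFamily (relGamma2 Γ₀ Γ₁ χ) z ↔
      ∃ a : K, (u + a, v) ∈ weylFamily χ z ∧ v = -M z a := by
  constructor
  · rintro ⟨f, f₁, f₂, h, hp, hf⟩
    obtain ⟨h1, h2⟩ := Prod.mk_inj.1 hp
    obtain ⟨rfl, rfl⟩ := Prod.mk_inj.1 h2
    obtain ⟨hf₁, rfl⟩ := oplus_eq_smul_iff.1 h1
    refine ⟨Γ₀ f₁, ⟨f.snd, by simpa using hf⟩, ?_⟩
    rw [← hM z hz f₁ (by rw [hf₁])]
  · rintro ⟨a, ⟨g, hg⟩, rfl⟩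
    obtain ⟨f, hf, h0⟩ := hΓ.exists_eigen hA hz a
    have h1 := hM z hz f hf
    rw [h0] at h1
    refine ⟨WithLp.toLp 2 (f.1.1, g), f, (g, z • g), u + a, ?_, by rwa [h1]⟩
    rw [h1, h0]
    refine Prod.mk_inj.2 ⟨oplus_eq_smul_iff.2 ⟨Prod.ext rfl hf, rfl⟩, ?_⟩
    rw [neg_add_cancel_comm_assoc]

end Coupling

/-! ### Nevanlinna pairs and bounded inverses. -/

section NevanlinnaPair

variable {K : Type*} [NormedAddCommGroup K] [InnerProductSpace ℂ K]

theorem IsRepresentedBy.mem_iff {τ : ℂ → LinRel K} {Φ Ψ : ℂ → K →L[ℂ] K}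
    (h : IsRepresentedBy τ Φ Ψ) {z : ℂ} (hz : z.im ≠ 0) {u v : K} :
    (u, v) ∈ τ z ↔ ∃ k, Φ z k = u ∧ Ψ z k = v := by
  rw [h z hz]
  simp

/-- A common null vector of `Φ z` and `Ψ z` is annihilated by the invertible operator `Ψ z ± iΦ z`.
-/
theorem IsNevanlinnaPair.eq_zero [CompleteSpace K] {Φ Ψ : ℂ → K →L[ℂ] K}
    (h : IsNevanlinnaPair Φ Ψ) {z : ℂ} (hz : z.im ≠ 0) {k : K} (h0 : Φ z k = 0)
    (h1 : Ψ z k = 0) : k = 0 := by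
  rcases lt_or_gt_of_ne hz with hz | hz
  · refine (ContinuousLinearMap.isUnit_iff_bijective.1 (h.n3_lower z hz)).1 ?_
    simp [h0, h1]
  · refine (ContinuousLinearMap.isUnit_iff_bijective.1 (h.n3_upper z hz)).1 ?_
    simp [h0, h1]

theorem inverse_apply_self_of_isUnit {X : K →L[ℂ] K} (hX : IsUnit X) (k : K) :
    Ring.inverse X (X k) = k :=
  DFunLike.congr_fun (Ring.inverse_mul_cancel X hX) k

theorem self_apply_inverse_of_isUnit {X : K →L[ℂ] K} (hX : IsUnit X) (k : K) :
    X (Ring.inverse X k) = k :=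
  DFunLike.congr_fun (Ring.mul_inverse_cancel X hX) k

end NevanlinnaPair

end BoundaryRel

end

theorem theorem6p8
    {H₁ H₂ K : Type*}
    [NormedAddCommGroup H₁] [InnerProductSpace ℂ H₁] [CompleteSpace H₁]
    [NormedAddCommGroup H₂] [InnerProductSpace ℂ H₂] [CompleteSpace H₂]
    [NormedAddCommGroup K] [InnerProductSpace ℂ K] [CompleteSpace K]
    (A : BoundaryRel.LinRel H₁) (hA : BoundaryRel.IsSymmetricRel A)
    (Γ₀ Γ₁ : A.adjoint →ₗ[ℂ] K) (hΓ : BoundaryRel.IsBoundaryTriplet A Γ₀ Γ₁)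
    (S₂ : BoundaryRel.LinRel H₂) (χ : BoundaryRel.BdRel H₂ K)
    (hχ : BoundaryRel.IsBoundaryRelation χ S₂) :
    -- `H⁽¹⁾` is closed and symmetric
    (BoundaryRel.IsClosedRel (BoundaryRel.relH1 Γ₀ Γ₁ χ) ∧
      BoundaryRel.IsSymmetricRel (BoundaryRel.relH1 Γ₀ Γ₁ χ)) ∧
    -- `Γ⁽¹⁾` is a boundary relation for the adjoint of `H⁽¹⁾` with (B1)--(B3)
    (BoundaryRel.IsBoundaryRelation (BoundaryRel.relGamma1 Γ₀ Γ₁ χ) (BoundaryRel.relH1 Γ₀ Γ₁ χ) ∧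
      BoundaryRel.SatisfiesB (BoundaryRel.relGamma1 Γ₀ Γ₁ χ)) ∧
    -- `H⁽²⁾` is closed and symmetric
    (BoundaryRel.IsClosedRel (BoundaryRel.relH2 Γ₀ Γ₁ χ) ∧
      BoundaryRel.IsSymmetricRel (BoundaryRel.relH2 Γ₀ Γ₁ χ)) ∧
    -- `Γ⁽²⁾` is a boundary relation for the adjoint of `H⁽²⁾` with (B1)--(B3)
    (BoundaryRel.IsBoundaryRelation (BoundaryRel.relGamma2 Γ₀ Γ₁ χ) (BoundaryRel.relH2 Γ₀ Γ₁ χ) ∧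
      BoundaryRel.SatisfiesB (BoundaryRel.relGamma2 Γ₀ Γ₁ χ)) ∧
    ∀ M : ℂ → K →L[ℂ] K, BoundaryRel.IsTripletWeylFunction A Γ₀ Γ₁ M →
      -- the Weyl function of `Γ⁽¹⁾` is `-(τ + M)⁻¹`, where `τ` is the Weyl family of `χ`
      (∀ z : ℂ, z.im ≠ 0 → ∀ u v : K,
        (u, v) ∈ BoundaryRel.weylFamily (BoundaryRel.relGamma1 Γ₀ Γ₁ χ) z ↔
          ∃ w : K, (-v, w) ∈ BoundaryRel.weylFamily χ z ∧ u = w + M z (-v)) ∧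
      ∀ Φ Ψ : ℂ → K →L[ℂ] K, BoundaryRel.IsNevanlinnaPair Φ Ψ →
        BoundaryRel.IsRepresentedBy (BoundaryRel.weylFamily χ) Φ Ψ →
        -- `Ψ + M Φ` is boundedly invertible
        (∀ z : ℂ, z.im ≠ 0 → IsUnit (Ψ z + M z * Φ z)) ∧
        -- the Weyl function of `Γ⁽¹⁾`
        BoundaryRel.IsWeylFunction (BoundaryRel.relGamma1 Γ₀ Γ₁ χ)
          (fun z => -(Φ z * Ring.inverse (Ψ z + M z * Φ z))) ∧
        -- the Weyl function of `Γ⁽²⁾`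
        BoundaryRel.IsWeylFunction (BoundaryRel.relGamma2 Γ₀ Γ₁ χ)
          (fun z => Ψ z * Ring.inverse (Ψ z + M z * Φ z) * M z) := by
  have hg := hχ.green
  have hm := hχ.maximal
  have hB1 := BoundaryRel.relGamma1_isBoundaryRelation hA hΓ hg hm
  have hS1 := BoundaryRel.relGamma1_satisfiesB hA hΓ hg hm
  have hg' := BoundaryRel.transpose_green hg
  have hm' := BoundaryRel.transpose_maximal hm
  have hB2 := BoundaryRel.relGamma1_isBoundaryRelation hA hΓ.transpose hg' hm'
  have hS2 := BoundaryRel.relGamma1_satisfiesB hA hΓ.transpose hg' hm'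
  rw [← BoundaryRel.relGamma2_eq] at hB2 hS2
  rw [← BoundaryRel.relH2_eq] at hB2
  refine ⟨⟨hB1.closed, hB1.symmetric⟩, ⟨hB1, hS1⟩, ⟨hB2.closed, hB2.symmetric⟩, ⟨hB2, hS2⟩,
    fun M hM => ?_⟩
  have hW1 := fun (z : ℂ) (hz : z.im ≠ 0) (u v : K) =>
    BoundaryRel.mem_weylFamily_relGamma1_iff (χ := χ) hA hΓ hM hz (u := u) (v := v)
  refine ⟨hW1, fun Φ Ψ hN hrep => ?_⟩
  have hunit : ∀ z : ℂ, z.im ≠ 0 → IsUnit (Ψ z + M z * Φ z) := by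
    intro z hz
    rw [ContinuousLinearMap.isUnit_iff_bijective]
    constructor
    · rw [injective_iff_map_eq_zero]
      intro k hk
      have hk' : Ψ z k + M z (Φ z k) = 0 := hk
      -- The pair `{0, -Φ k}` lies in the Weyl family of `relGamma1`, which is single-valued.
      have h0 : Φ z k = 0 := by
        rw [← neg_eq_zero]
        refine hS1.eq_zero_of_mem_weylFamily hz ((hW1 z hz _ _).2 ⟨Ψ z k, ?_, ?_⟩)
        · exact (hrep.mem_iff hz).2 ⟨k, by rw [neg_neg], rfl⟩
        · rw [neg_neg, hk']
      rw [h0, map_zero, add_zero] at hk'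
      exact hN.eq_zero hz h0 hk'
    · intro u
      obtain ⟨v, hv⟩ := hS1.exists_mem_weylFamily hz u
      obtain ⟨w, hw, rfl⟩ := (hW1 z hz _ _).1 hv
      obtain ⟨k, hk, rfl⟩ := (hrep.mem_iff hz).1 hw
      exact ⟨k, by rw [← hk]; rfl⟩
  refine ⟨hunit, fun z hz => ?_, fun z hz => ?_⟩
  · ext ⟨u, v⟩
    rw [hW1 z hz, LinearMap.mem_graph_iff]
    change _ ↔ v = -Φ z (Ring.inverse (Ψ z + M z * Φ z) u)
    constructor
    · rintro ⟨w, hw, rfl⟩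
      obtain ⟨k, hk, rfl⟩ := (hrep.mem_iff hz).1 hw
      rw [← hk, show Ψ z k + M z (Φ z k) = (Ψ z + M z * Φ z) k from rfl,
        BoundaryRel.inverse_apply_self_of_isUnit (hunit z hz), hk, neg_neg]
    · rintro rfl
      refine ⟨Ψ z (Ring.inverse (Ψ z + M z * Φ z) u), ?_, ?_⟩
      · exact (hrep.mem_iff hz).2 ⟨_, by rw [neg_neg], rfl⟩
      · rw [neg_neg]
        exact (BoundaryRel.self_apply_inverse_of_isUnit (hunit z hz) u).symm
  · ext ⟨u, v⟩
    rw [BoundaryRel.mem_weylFamily_relGamma2_iff hA hΓ hM hz, LinearMap.mem_graph_iff]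
    change _ ↔ v = Ψ z (Ring.inverse (Ψ z + M z * Φ z) (M z u))
    constructor
    -- With `u + a = Φ k` and `Ψ k = v = -M a`, eliminating `a` gives `(Ψ + MΦ) k = M u`.
    · rintro ⟨a, hw, hv⟩
      obtain ⟨k, hk, rfl⟩ := (hrep.mem_iff hz).1 hw
      have hX : (Ψ z + M z * Φ z) k = M z u := by
        change Ψ z k + M z (Φ z k) = M z u
        rw [hv, hk, map_add]
        abel
      rw [← hX, BoundaryRel.inverse_apply_self_of_isUnit (hunit z hz)]
    · rintro rfl
      have hX : Ψ z (Ring.inverse (Ψ z + M z * Φ z) (M z u)) +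
          M z (Φ z (Ring.inverse (Ψ z + M z * Φ z) (M z u))) = M z u :=
        BoundaryRel.self_apply_inverse_of_isUnit (hunit z hz) (M z u)
      refine ⟨Φ z (Ring.inverse (Ψ z + M z * Φ z) (M z u)) - u, ?_, ?_⟩
      · exact (hrep.mem_iff hz).2 ⟨_, by rw [add_sub_cancel], rfl⟩
      · rw [map_sub, neg_sub]
        exact eq_sub_of_add_eq hX
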